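/- Let $E$ be a real Banach lattice, and order its norm dual $E^*$ by $f\le g$ iff $f(x)\le g(x)$ for all $0\le x\in E$; with this order $E^*$ is a vector lattice. A sequence $(x^*_n)$ in $E^*$ is uaw-null (unbounded absolutely weakly null) if for every $0\le u^*\in E^*$ the sequence $|x^*_n|\wedge u^*$ converges to $0$ in the weak topology $\sigma(E^*,E^{**})$. Call $E$ order continuous if $\|x_\alpha\|\to 0$ for every net $(x_\alpha)$ in $E$ with $x_\alpha\downarrow 0$. Then the following are equivalent: (i) $E$ is order continuous; (ii) every norm bounded uaw-null sequence $(x^*_n)$ in $E^*$ is $w^*$-null, that is, $x^*_n(x)\to 0$ for every $x\in E$; (iii) every norm bounded uaw-null sequence $(x^*_n)$ in $E^*$ is $|\sigma|(E^*,E)$-null, that is, $|x^*_n|(|x|)\to 0$ for every $x\in E$. -/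

import Mathlib

open Filter Topology

noncomputable section

namespace BanachLattice

/-! ### The dual of a Banach lattice, as a lattice -/

section Dual

variable {E : Type*} [NormedAddCommGroup E] [NormedSpace ℝ E] [Lattice E]
  [IsOrderedAddMonoid E] [HasSolidNorm E]

/-- The dual order: `f ≤ g` iff `f x ≤ g x` for every `x ≥ 0`. -/
instance dualPartialOrder : PartialOrder (StrongDual ℝ E) where
  le f g := ∀ x : E, 0 ≤ x → f x ≤ g x
  le_refl _ _ _ := le_rfl
  le_trans _ _ _ hfg hgh x hx := (hfg x hx).trans (hgh x hx)
  le_antisymm f g hfg hgf := by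
    have key : ∀ x : E, 0 ≤ x → f x = g x := fun x hx => le_antisymm (hfg x hx) (hgf x hx)
    ext x
    rw [← posPart_sub_negPart x, map_sub, map_sub, key _ (posPart_nonneg x),
      key _ (negPart_nonneg x)]

theorem dual_le_iff {f g : StrongDual ℝ E} : f ≤ g ↔ ∀ x : E, 0 ≤ x → f x ≤ g x := Iff.rfl

/-- The Riesz-Kantorovich formula `h⁺(x) = sup {h y : 0 ≤ y ≤ x}`, for `x ≥ 0`. -/
def rieszSup (h : StrongDual ℝ E) (x : E) : ℝ := sSup (h '' Set.Icc 0 x)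

theorem rieszSup_bound (h : StrongDual ℝ E) (x : E) :
    ∀ r ∈ h '' Set.Icc 0 x, r ≤ ‖h‖ * ‖x‖ := by
  rintro _ ⟨y, ⟨hy0, hyx⟩, rfl⟩
  have h1 : ‖y‖ ≤ ‖x‖ := norm_le_norm_of_abs_le_abs (by
    rwa [abs_of_nonneg hy0, abs_of_nonneg (hy0.trans hyx)])
  calc h y ≤ ‖h y‖ := le_abs_self _
    _ ≤ ‖h‖ * ‖y‖ := h.le_opNorm y
    _ ≤ ‖h‖ * ‖x‖ := by gcongr

theorem le_rieszSup (h : StrongDual ℝ E) {x y : E} (hy : 0 ≤ y) (hyx : y ≤ x) :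
    h y ≤ rieszSup h x :=
  le_csSup ⟨‖h‖ * ‖x‖, fun r hr => rieszSup_bound h x r hr⟩ ⟨y, ⟨hy, hyx⟩, rfl⟩

theorem rieszSup_le (h : StrongDual ℝ E) {x : E} (hx : 0 ≤ x) {r : ℝ}
    (hr : ∀ y, 0 ≤ y → y ≤ x → h y ≤ r) : rieszSup h x ≤ r := by
  refine csSup_le ((Set.nonempty_Icc.2 hx).image h) ?_
  rintro _ ⟨y, ⟨hy0, hyx⟩, rfl⟩
  exact hr y hy0 hyx

theorem rieszSup_nonneg (h : StrongDual ℝ E) {x : E} (hx : 0 ≤ x) : 0 ≤ rieszSup h x := by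
  simpa using le_rieszSup h (le_refl 0) hx

theorem rieszSup_add (h : StrongDual ℝ E) {a b : E} (ha : 0 ≤ a) (hb : 0 ≤ b) :
    rieszSup h (a + b) = rieszSup h a + rieszSup h b := by
  apply le_antisymm
  · apply rieszSup_le h (add_nonneg ha hb)
    intro y hy hyab
    have h1 : h y = h (y ⊓ a) + h (y - y ⊓ a) := by rw [← map_add]; congr 1; abel
    rw [h1]
    apply add_le_add
    · exact le_rieszSup h (le_inf hy ha) inf_le_right
    · apply le_rieszSup h (sub_nonneg.2 inf_le_left)
      rw [sub_le_iff_le_add, add_inf]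
      exact le_inf (le_add_of_nonneg_left hb) (by rwa [add_comm b a])
  · rw [← le_sub_iff_add_le]
    apply rieszSup_le h ha
    intro y hy hya
    rw [le_sub_iff_add_le, ← le_sub_iff_add_le']
    apply rieszSup_le h hb
    intro z hz hzb
    rw [le_sub_iff_add_le', ← map_add]
    exact le_rieszSup h (add_nonneg hy hz) (add_le_add hya hzb)

theorem rieszSup_ext (h : StrongDual ℝ E) {x a b : E} (ha : 0 ≤ a) (hb : 0 ≤ b)
    (hx : x = a - b) : rieszSup h x⁺ - rieszSup h x⁻ = rieszSup h a - rieszSup h b := by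
  have h1 : x⁺ + b = a + x⁻ := by
    have := posPart_sub_negPart x
    rw [← sub_eq_sub_iff_add_eq_add, this, hx]
  have h2 := congrArg (rieszSup h) h1
  rw [rieszSup_add h (posPart_nonneg x) hb, rieszSup_add h ha (negPart_nonneg x)] at h2
  linarith

/-- The positive part `h⁺` of a functional, as an additive map on the whole space. -/
def dualPosPartHom (h : StrongDual ℝ E) : E →+ ℝ :=
  AddMonoidHom.mk' (fun x => rieszSup h x⁺ - rieszSup h x⁻) (by
    intro x y
    rw [rieszSup_ext h (add_nonneg (posPart_nonneg x) (posPart_nonneg y))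
      (add_nonneg (negPart_nonneg x) (negPart_nonneg y)) (x := x + y) (by
        conv_lhs => rw [← posPart_sub_negPart x, ← posPart_sub_negPart y]
        abel),
      rieszSup_add h (posPart_nonneg x) (posPart_nonneg y),
      rieszSup_add h (negPart_nonneg x) (negPart_nonneg y)]
    ring)

theorem dualPosPartHom_bound (h : StrongDual ℝ E) (x : E) :
    ‖dualPosPartHom h x‖ ≤ ‖h‖ * ‖x‖ := by
  have key : ∀ y : E, 0 ≤ y → y ≤ |x| → 0 ≤ rieszSup h y ∧ rieszSup h y ≤ ‖h‖ * ‖x‖ := by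
    intro y hy hyx
    refine ⟨rieszSup_nonneg h hy, rieszSup_le h hy fun z hz hzy => ?_⟩
    have := rieszSup_bound h |x| (h z) ⟨z, ⟨hz, hzy.trans hyx⟩, rfl⟩
    rwa [norm_abs_eq_norm] at this
  have h1 := key x⁺ (posPart_nonneg x) (sup_le (le_abs_self x) (abs_nonneg x))
  have h2 := key x⁻ (negPart_nonneg x) (sup_le (neg_le_abs x) (abs_nonneg x))
  change |rieszSup h x⁺ - rieszSup h x⁻| ≤ _
  rw [abs_le]
  constructor <;> linarith

/-- The positive part `h⁺` of a functional. -/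
def dualPosPart (h : StrongDual ℝ E) : StrongDual ℝ E :=
  (dualPosPartHom h).toRealLinearMap
    (AddMonoidHomClass.continuous_of_bound (dualPosPartHom h) ‖h‖ (dualPosPartHom_bound h))

theorem dualPosPart_apply (h : StrongDual ℝ E) {x : E} (hx : 0 ≤ x) :
    dualPosPart h x = rieszSup h x := by
  change rieszSup h x⁺ - rieszSup h x⁻ = _
  rw [rieszSup_ext h hx le_rfl (sub_zero x).symm]
  have : rieszSup h (0 : E) = 0 := by
    simpa using rieszSup_add h (le_refl (0 : E)) (le_refl (0 : E))
  rw [this, sub_zero]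

/-- The dual is a lattice, with `f ⊔ g = g + (f - g)⁺` and `f ⊓ g = f - (f - g)⁺`. -/
instance dualLattice : Lattice (StrongDual ℝ E) where
  __ := dualPartialOrder
  sup f g := g + dualPosPart (f - g)
  inf f g := f - dualPosPart (f - g)
  le_sup_left f g x hx := by
    change f x ≤ g x + dualPosPart (f - g) x
    rw [dualPosPart_apply _ hx]
    have := le_rieszSup (f - g) hx le_rfl
    rw [sub_apply] at this
    linarith
  le_sup_right f g x hx := by
    change g x ≤ g x + dualPosPart (f - g) x
    rw [dualPosPart_apply _ hx]
    linarith [rieszSup_nonneg (f - g) hx]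
  sup_le f g k hf hg x hx := by
    change g x + dualPosPart (f - g) x ≤ k x
    rw [dualPosPart_apply _ hx]
    have : rieszSup (f - g) x ≤ k x - g x := by
      apply rieszSup_le _ hx
      intro y hy hyx
      have h1 := hf y hy
      have h2 := hg (x - y) (sub_nonneg.2 hyx)
      rw [map_sub, map_sub] at h2
      rw [sub_apply]
      linarith
    linarith
  inf_le_left f g x hx := by
    change f x - dualPosPart (f - g) x ≤ f x
    rw [dualPosPart_apply _ hx]
    linarith [rieszSup_nonneg (f - g) hx]
  inf_le_right f g x hx := by
    change f x - dualPosPart (f - g) x ≤ g x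
    rw [dualPosPart_apply _ hx]
    have := le_rieszSup (f - g) hx le_rfl
    rw [sub_apply] at this
    linarith
  le_inf k f g hf hg x hx := by
    change k x ≤ f x - dualPosPart (f - g) x
    rw [dualPosPart_apply _ hx]
    have : rieszSup (f - g) x ≤ f x - k x := by
      apply rieszSup_le _ hx
      intro y hy hyx
      have h1 := hg y hy
      have h2 := hf (x - y) (sub_nonneg.2 hyx)
      rw [map_sub, map_sub] at h2
      rw [sub_apply]
      linarith
    linarith

instance dualIsOrderedAddMonoid : IsOrderedAddMonoid (StrongDual ℝ E) where
  add_le_add_left _ _ hfg _ x hx := add_le_add (hfg x hx) le_rfl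

end Dual

/-! ### Order continuity and modes of convergence -/

/-- The norm of `E` is order continuous: `x_α ↓ 0` implies `‖x_α‖ → 0`, for every net `(x_α)`. -/
def IsOrderContinuous.{u} (E : Type u) [NormedAddCommGroup E] [Lattice E] : Prop :=
  ∀ (ι : Type u) [Preorder ι] [IsDirectedOrder ι] [Nonempty ι] (x : ι → E),
    Antitone x → IsGLB (Set.range x) 0 → Tendsto (fun i => ‖x i‖) atTop (𝓝 0)

/-- Unbounded absolute weak convergence of `x` to `a` along `l`: for each `u ≥ 0`,
`|x_i - a| ⊓ u` converges to `0` in the weak topology. -/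
def UAWTendsto {ι F : Type*} [NormedAddCommGroup F] [NormedSpace ℝ F] [Lattice F]
    (x : ι → F) (l : Filter ι) (a : F) : Prop :=
  ∀ u : F, 0 ≤ u → Tendsto (fun i => toWeakSpace ℝ F (|x i - a| ⊓ u)) l (𝓝 0)

/-- Convergence in the weak* topology `σ(E*, E)`. -/
def WeakStarTendsto {ι E : Type*} [NormedAddCommGroup E] [NormedSpace ℝ E]
    (f : ι → StrongDual ℝ E) (l : Filter ι) (g : StrongDual ℝ E) : Prop :=
  Tendsto (fun i => StrongDual.toWeakDual (f i)) l (𝓝 (StrongDual.toWeakDual g))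

/-- Convergence in the absolute weak* topology `|σ|(E*, E)`, the topology generated by the
seminorms `f ↦ |f|(|x|)`, `x ∈ E`. -/
def AbsWeakStarTendsto {ι E : Type*} [NormedAddCommGroup E] [NormedSpace ℝ E] [Lattice E]
    [IsOrderedAddMonoid E] [HasSolidNorm E]
    (f : ι → StrongDual ℝ E) (l : Filter ι) (g : StrongDual ℝ E) : Prop :=
  ∀ x : E, Tendsto (fun i => |f i - g| |x|) l (𝓝 0)

end BanachLattice

end

namespace BanachLattice


section LatticeGroup

variable {G : Type*} [AddCommGroup G] [Lattice G] [IsOrderedAddMonoid G]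

theorem inf_add_le_inf_add_inf {a b c : G} (ha : 0 ≤ a) (hb : 0 ≤ b) (hc : 0 ≤ c) :
    a ⊓ (b + c) ≤ a ⊓ b + a ⊓ c := by
  rw [add_inf, inf_add, inf_add]
  refine le_inf (le_inf ?_ ?_) (le_inf ?_ inf_le_right)
  · exact inf_le_left.trans (le_add_of_nonneg_left ha)
  · exact inf_le_left.trans (le_add_of_nonneg_left hb)
  · exact inf_le_left.trans (le_add_of_nonneg_right hc)

theorem inf_eq_zero_mono {a b c d : G} (ha : 0 ≤ a) (hb : 0 ≤ b) (hac : a ≤ c) (hbd : b ≤ d)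
    (h : c ⊓ d = 0) : a ⊓ b = 0 :=
  le_antisymm (h ▸ inf_le_inf hac hbd) (le_inf ha hb)

theorem inf_add_eq_zero {a b c : G} (ha : 0 ≤ a) (hb : 0 ≤ b) (hc : 0 ≤ c)
    (hab : a ⊓ b = 0) (hac : a ⊓ c = 0) : a ⊓ (b + c) = 0 := by
  refine le_antisymm ?_ (le_inf ha (add_nonneg hb hc))
  simpa [hab, hac] using inf_add_le_inf_add_inf ha hb hc

theorem inf_nsmul_eq_zero {a b : G} (ha : 0 ≤ a) (hb : 0 ≤ b) (hab : a ⊓ b = 0) (k : ℕ) :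
    a ⊓ k • b = 0 := by
  induction k with
  | zero => simpa using ha
  | succ k ih =>
    rw [succ_nsmul]
    exact inf_add_eq_zero ha (nsmul_nonneg hb k) hb ih hab

theorem inf_sum_eq_zero {ι : Type*} {a : G} (ha : 0 ≤ a) {v : ι → G} (hv : ∀ i, 0 ≤ v i)
    (s : Finset ι) (h : ∀ i ∈ s, a ⊓ v i = 0) : a ⊓ ∑ i ∈ s, v i = 0 := by
  classical
  induction s using Finset.induction_on with
  | empty => simpa using ha
  | insert i s hi ih =>
    rw [Finset.sum_insert hi]
    exact inf_add_eq_zero ha (hv i) (Finset.sum_nonneg fun j _ => hv j)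
      (h i (Finset.mem_insert_self i s)) (ih fun j hj => h j (Finset.mem_insert_of_mem hj))

theorem sum_le_of_pairwise_inf_eq_zero {ι : Type*} {y : G} (hy : 0 ≤ y) {v : ι → G}
    (hv : ∀ i, 0 ≤ v i) (hvy : ∀ i, v i ≤ y) (hd : Pairwise fun i j => v i ⊓ v j = 0)
    (s : Finset ι) : ∑ i ∈ s, v i ≤ y := by
  classical
  induction s using Finset.induction_on with
  | empty => simpa using hy
  | insert i s hi ih =>
    rw [Finset.sum_insert hi, ← inf_add_sup, inf_sum_eq_zero (hv i) hv s, zero_add]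
    · exact sup_le (hvy i) ih
    · intro j hj
      exact hd fun h => hi (h ▸ hj)

theorem posPart_inf_posPart_neg (a : G) : a⁺ ⊓ (-a)⁺ = 0 := by
  rw [posPart_neg]; exact posPart_inf_negPart_eq_zero a

theorem le_of_inf_eq_zero_of_le_add {r a b : G} (hr : 0 ≤ r) (ha : 0 ≤ a) (hb : 0 ≤ b)
    (h : r ≤ a + b) (hrb : r ⊓ b = 0) : r ≤ a := by
  have := inf_add_le_inf_add_inf hr ha hb
  rw [inf_eq_left.2 h, hrb, add_zero] at this
  exact this.trans inf_le_right

/-- If no multiple `j • c` with `j ≤ p` lies between `b + s` and `a - s`, then `a - b` is at most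
`c` up to `2 s`. -/
theorem sub_le_of_crossing_le {a b c s : G} {p : ℕ} (hb : 0 ≤ b) (hs : 0 ≤ s) (hc : 0 ≤ c) (ha : a ≤ p • c)
    (h : ∀ j ≤ p, (a - j • c) ⊓ (j • c - b) ≤ s) : a - b ≤ c + 2 • s := by
  set r := (a - b - 2 • s - c)⁺ with hr
  have hr0 : 0 ≤ r := posPart_nonneg _
  have hcross : ∀ j ≤ p, (a - j • c - s)⁺ ⊓ (j • c - s - b)⁺ = 0 := by
    intro j hj
    have h1 : (a - j • c - s) ⊓ (j • c - s - b) ≤ 0 := by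
      have := h j hj
      have h2 : (a - j • c - s) ⊓ (j • c - s - b) = (a - j • c) ⊓ (j • c - b) - s := by
        rw [sub_eq_add_neg ((a - j • c) ⊓ (j • c - b)), inf_add]
        congr 1 <;> abel
      rw [h2]
      exact sub_nonpos.2 this
    let _ : DistribLattice G := AddCommGroup.toDistribLattice G
    have h2 : (a - j • c - s)⁺ ⊓ (j • c - s - b)⁺ = ((a - j • c - s) ⊓ (j • c - s - b))⁺ :=
      (sup_inf_right _ _ _).symm
    rw [h2]
    exact posPart_eq_zero.2 h1
  have key : ∀ j ≤ p, r ⊓ (j • c - s - b)⁺ = 0 := by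
    intro j
    induction j with
    | zero =>
      intro _
      have : ((0 : ℕ) • c - s - b)⁺ = 0 := by
        rw [posPart_eq_zero, zero_nsmul, zero_sub, sub_nonpos]
        exact (neg_nonpos.2 hs).trans hb
      rw [this]; exact inf_eq_right.2 hr0
    | succ j ih =>
      intro hj
      have h1 : r ≤ (a - (j + 1) • c - s)⁺ := by
        refine le_of_inf_eq_zero_of_le_add hr0 (posPart_nonneg _) (posPart_nonneg _) ?_
          (ih (by omega))
        refine sup_le ?_ (add_nonneg (posPart_nonneg _) (posPart_nonneg _))
        calc a - b - 2 • s - c = (a - (j + 1) • c - s) + (j • c - s - b) := by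
              rw [succ_nsmul c, two_nsmul]; abel
          _ ≤ _ := add_le_add (le_posPart _) (le_posPart _)
      exact inf_eq_zero_mono hr0 (posPart_nonneg _) h1 le_rfl (hcross _ hj)
  have h1 : r ≤ (p • c - s - b)⁺ := by
    apply posPart_mono
    calc a - b - 2 • s - c ≤ p • c - b - 2 • s - 0 := by gcongr
      _ = p • c - s - b - s := by rw [two_nsmul]; abel
      _ ≤ _ := sub_le_self _ hs
  have h2 : r = 0 := by
    rw [← key p le_rfl]; exact (inf_eq_left.2 h1).symm
  have h3 := posPart_eq_zero.1 h2
  rw [sub_sub, sub_nonpos, ← add_comm] at h3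
  exact h3

end LatticeGroup


section OrderContinuity

variable {E : Type*} [NormedAddCommGroup E] [Lattice E] [IsOrderedAddMonoid E] [HasSolidNorm E]

theorem norm_le_norm_of_nonneg_of_le {a b : E} (ha : 0 ≤ a) (hab : a ≤ b) : ‖a‖ ≤ ‖b‖ :=
  norm_le_norm_of_abs_le_abs (by rwa [abs_of_nonneg ha, abs_of_nonneg (ha.trans hab)])

/-- In an order continuous lattice, increasing order bounded sequences are Cauchy. -/
theorem IsOrderContinuous.cauchySeq_of_monotone [NormedSpace ℝ E] (hE : IsOrderContinuous E)
    {y : ℕ → E} (hy : Monotone y) {x : E} (hx : ∀ n, y n ≤ x) : CauchySeq y := by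
  let B := {b : E // ∀ n, y n ≤ b}
  have hne : Nonempty (Bᵒᵈ × ℕ) := ⟨(OrderDual.toDual ⟨x, hx⟩, 0)⟩
  have hdir : IsDirectedOrder (Bᵒᵈ × ℕ) := by
    refine ⟨fun p q => ⟨(OrderDual.toDual ⟨(OrderDual.ofDual p.1).1 ⊓ (OrderDual.ofDual q.1).1,
      fun n => le_inf ((OrderDual.ofDual p.1).2 n) ((OrderDual.ofDual q.1).2 n)⟩,
      max p.2 q.2), ⟨?_, le_max_left _ _⟩, ⟨?_, le_max_right _ _⟩⟩⟩
    · exact (inf_le_left : (OrderDual.ofDual p.1).1 ⊓ (OrderDual.ofDual q.1).1 ≤ _)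
    · exact (inf_le_right : (OrderDual.ofDual p.1).1 ⊓ (OrderDual.ofDual q.1).1 ≤ _)
  let z : Bᵒᵈ × ℕ → E := fun p => (OrderDual.ofDual p.1).1 - y p.2
  have hz : Antitone z := fun p q hpq => sub_le_sub (show (OrderDual.ofDual q.1).1 ≤
    (OrderDual.ofDual p.1).1 from hpq.1) (hy hpq.2)
  have hz0 : ∀ p, 0 ≤ z p := fun p => sub_nonneg.2 ((OrderDual.ofDual p.1).2 p.2)
  have hglb : IsGLB (Set.range z) 0 := by
    refine ⟨by rintro _ ⟨p, rfl⟩; exact hz0 p, fun c hc => ?_⟩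
    have hc' : ∀ b : B, ∀ n, c⁺ ≤ b.1 - y n := fun b n =>
      sup_le (hc ⟨(OrderDual.toDual b, n), rfl⟩) (sub_nonneg.2 (b.2 n))
    have hk : ∀ k : ℕ, ∀ n, y n ≤ x - k • c⁺ := by
      intro k
      induction k with
      | zero => simpa using hx
      | succ k ih =>
        intro n
        have := hc' ⟨_, ih⟩ n
        rw [succ_nsmul, ← sub_sub]
        exact le_sub_comm.1 this
    have hbound : ∀ k : ℕ, (k : ℝ) * ‖c⁺‖ ≤ ‖x - y 0‖ := by
      intro k
      have := norm_le_norm_of_nonneg_of_le (nsmul_nonneg (posPart_nonneg c) k)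
        (le_sub_comm.1 (hk k 0))
      rwa [← Nat.cast_smul_eq_nsmul ℝ, norm_smul, Real.norm_natCast] at this
    have h0 : ‖c⁺‖ = 0 := by
      by_contra hne
      have hpos : 0 < ‖c⁺‖ := lt_of_le_of_ne (norm_nonneg _) (Ne.symm hne)
      obtain ⟨k, hk⟩ := exists_nat_gt (‖x - y 0‖ / ‖c⁺‖)
      rw [div_lt_iff₀ hpos] at hk
      exact absurd (hbound k) (not_le.2 hk)
    exact posPart_eq_zero.1 (norm_eq_zero.1 h0)
  have hlim := hE _ z hz hglb
  rw [Metric.cauchySeq_iff']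
  intro ε hε
  obtain ⟨p, hp⟩ := ((tendsto_order.1 hlim).2 ε hε).exists
  refine ⟨p.2, fun n hn => ?_⟩
  rw [dist_eq_norm]
  refine lt_of_le_of_lt (norm_le_norm_of_nonneg_of_le (sub_nonneg.2 (hy hn)) ?_) hp
  exact sub_le_sub_right ((OrderDual.ofDual p.1).2 n) _

/-- If the increments of increasing order bounded sequences are norm null, then the lattice is
order continuous. -/
theorem isOrderContinuous_of_increments [CompleteSpace E]
    (h : ∀ (y : ℕ → E) (x : E), Monotone y → (∀ n, 0 ≤ y n) → (∀ n, y n ≤ x) →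
      Tendsto (fun n => ‖y (n + 1) - y n‖) atTop (𝓝 0)) : IsOrderContinuous E := by
  intro ι _ _ _ x hx hglb
  have hx0 : ∀ i, 0 ≤ x i := fun i => hglb.1 ⟨i, rfl⟩
  have hC : ∀ ε > 0, ∃ i, ∀ j, i ≤ j → ‖x i - x j‖ < ε := by
    by_contra! hcon
    obtain ⟨ε, hε, hcon⟩ := hcon
    choose g hg hgε using hcon
    obtain ⟨i₀⟩ := ‹Nonempty ι›
    let s : ℕ → ι := fun n => g^[n] i₀
    have hs : ∀ n, s (n + 1) = g (s n) := fun n => Function.iterate_succ_apply' g n i₀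
    have hmono : Monotone s := monotone_nat_of_le_succ fun n => by rw [hs]; exact hg _
    have := h (fun n => x i₀ - x (s n)) (x i₀)
      (fun m n hmn => sub_le_sub_left (hx (hmono hmn)) _)
      (fun n => sub_nonneg.2 (hx (hmono (Nat.zero_le n)))) (fun n => sub_le_self _ (hx0 _))
    obtain ⟨n, hn⟩ := ((tendsto_order.1 this).2 ε hε).exists
    rw [sub_sub_sub_cancel_left, hs] at hn
    exact absurd (hgε (s n)) (not_le.2 hn)
  have hcau : CauchySeq x := by
    rw [CauchySeq, Metric.cauchy_iff]
    refine ⟨inferInstance, fun ε hε => ?_⟩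
    obtain ⟨i, hi⟩ := hC (ε / 2) (half_pos hε)
    refine ⟨x '' Set.Ici i, image_mem_map (Ici_mem_atTop i), ?_⟩
    rintro _ ⟨j, hj, rfl⟩ _ ⟨k, hk, rfl⟩
    have h1 := hi j hj
    have h2 := hi k hk
    rw [← dist_eq_norm] at h1 h2
    linarith [dist_triangle_left (x j) (x k) (x i)]
  obtain ⟨a, ha⟩ := cauchySeq_tendsto_of_complete hcau
  have ha0 : a = 0 := by
    refine le_antisymm (hglb.2 ?_) (ge_of_tendsto' ha hx0)
    rintro _ ⟨i, rfl⟩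
    exact le_of_tendsto ha ((eventually_ge_atTop i).mono fun j hj => hx hj)
  simpa [ha0] using ha.norm

/-- If disjoint order bounded sequences are norm null, then so are the increments of increasing
order bounded sequences. -/
theorem tendsto_increments_of_disjoint [NormedSpace ℝ E] [IsOrderedModule ℝ E]
    (h : ∀ (v : ℕ → E) (x : E), (∀ n, 0 ≤ v n) → (∀ n, v n ≤ x) →
      (Pairwise fun m n => v m ⊓ v n = 0) → Tendsto (fun n => ‖v n‖) atTop (𝓝 0))
    {y : ℕ → E} {x : E} (hy : Monotone y) (hy0 : ∀ n, 0 ≤ y n) (hyx : ∀ n, y n ≤ x) :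
    Tendsto (fun n => ‖y (n + 1) - y n‖) atTop (𝓝 0) := by
  have hx : 0 ≤ x := (hy0 0).trans (hyx 0)
  have hcross : ∀ a : E, 0 ≤ a → Tendsto (fun n => ‖((y (n + 1) - a) ⊓ (a - y n))⁺‖) atTop (𝓝 0) := by
    intro a ha
    have hle1 : ∀ n, ((y (n + 1) - a) ⊓ (a - y n))⁺ ≤ (y (n + 1) - a)⁺ :=
      fun n => posPart_mono inf_le_left
    have hle2 : ∀ n, ((y (n + 1) - a) ⊓ (a - y n))⁺ ≤ (a - y n)⁺ :=
      fun n => posPart_mono inf_le_right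
    have hlt : ∀ m n, m < n →
        ((y (m + 1) - a) ⊓ (a - y m))⁺ ⊓ ((y (n + 1) - a) ⊓ (a - y n))⁺ = 0 := by
      intro m n hmn
      refine inf_eq_zero_mono (posPart_nonneg _) (posPart_nonneg _) (hle1 m)
        ((hle2 n).trans (posPart_mono ?_)) (posPart_inf_posPart_neg _)
      rw [neg_sub]
      exact sub_le_sub_left (hy hmn) _
    refine h _ x (fun n => posPart_nonneg _) (fun n => sup_le ?_ hx) ?_
    · exact inf_le_left.trans ((sub_le_self _ ha).trans (hyx _))
    · intro m n hmn
      rcases lt_or_gt_of_ne hmn with hmn | hmn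
      · exact hlt m n hmn
      · rw [inf_comm]; exact hlt n m hmn
  rw [tendsto_order]
  refine ⟨fun a ha => Eventually.of_forall fun n => ha.trans_le (norm_nonneg _), fun ε hε => ?_⟩
  obtain ⟨p, hp⟩ := exists_nat_gt (2 * ‖x‖ / ε)
  have hp0 : (0 : ℝ) < p := lt_of_le_of_lt (by positivity) hp
  set c : E := (p : ℝ)⁻¹ • x with hc
  have hc0 : 0 ≤ c := smul_nonneg (inv_nonneg.2 hp0.le) hx
  have hpc : p • c = x := by
    rw [hc, ← Nat.cast_smul_eq_nsmul ℝ, smul_inv_smul₀ hp0.ne']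
  have hcn : ‖c‖ < ε / 2 := by
    rw [hc, norm_smul, norm_inv, Real.norm_natCast, inv_mul_lt_iff₀ hp0]
    rw [div_lt_iff₀ hε] at hp
    linarith
  let s : ℕ → E := fun n =>
    ∑ j ∈ Finset.range (p + 1), ((y (n + 1) - j • c) ⊓ (j • c - y n))⁺
  have hbound : ∀ n, ‖y (n + 1) - y n‖ ≤ ‖c‖ + 2 * ∑ j ∈ Finset.range (p + 1),
      ‖((y (n + 1) - j • c) ⊓ (j • c - y n))⁺‖ := by
    intro n
    have h1 : y (n + 1) - y n ≤ c + 2 • s n := by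
      refine sub_le_of_crossing_le (hy0 n) (Finset.sum_nonneg fun j _ => posPart_nonneg _) hc0
        (p := p) (hpc ▸ hyx _) fun j hj => (le_posPart _).trans ?_
      exact Finset.single_le_sum
        (f := fun j => ((y (n + 1) - j • c) ⊓ (j • c - y n))⁺)
        (fun j _ => posPart_nonneg _) (Finset.mem_range.2 (Nat.lt_succ_of_le hj))
    calc ‖y (n + 1) - y n‖ ≤ ‖c + 2 • s n‖ :=
          norm_le_norm_of_nonneg_of_le (sub_nonneg.2 (hy n.le_succ)) h1
      _ ≤ ‖c‖ + ‖2 • s n‖ := norm_add_le _ _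
      _ ≤ ‖c‖ + 2 * ‖s n‖ := by
          rw [two_nsmul, two_mul]
          gcongr
          exact norm_add_le _ _
      _ ≤ _ := by gcongr; exact norm_sum_le _ _
  have hlim : Tendsto (fun n => ‖c‖ + 2 * ∑ j ∈ Finset.range (p + 1),
      ‖((y (n + 1) - j • c) ⊓ (j • c - y n))⁺‖) atTop (𝓝 (‖c‖ + 2 * 0)) := by
    refine tendsto_const_nhds.add (Tendsto.const_mul _ ?_)
    rw [← Finset.sum_const_zero (s := Finset.range (p + 1))]
    exact tendsto_finsetSum _ fun j _ => hcross _ (nsmul_nonneg hc0 j)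
  refine ((tendsto_order.1 hlim).2 ε (by linarith)).mono fun n hn => (hbound n).trans_lt hn

end OrderContinuity


section DualLattice

variable {E : Type*} [NormedAddCommGroup E] [NormedSpace ℝ E] [Lattice E]
  [IsOrderedAddMonoid E] [HasSolidNorm E]

theorem dual_apply_mono {f : StrongDual ℝ E} (hf : 0 ≤ f) {x y : E} (hxy : x ≤ y) :
    f x ≤ f y := by
  have := hf (y - x) (sub_nonneg.2 hxy)
  rw [map_sub] at this
  simpa using this

theorem dual_apply_nonneg {f : StrongDual ℝ E} (hf : 0 ≤ f) {x : E} (hx : 0 ≤ x) : 0 ≤ f x := by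
  simpa using hf x hx

theorem abs_dual_apply_le_of_nonneg {f : StrongDual ℝ E} (hf : 0 ≤ f) (x : E) :
    |f x| ≤ f |x| := by
  refine abs_le'.2 ⟨dual_apply_mono hf (le_abs_self x), ?_⟩
  rw [← map_neg]
  exact dual_apply_mono hf (neg_le_abs x)

theorem abs_dual_apply_le (f : StrongDual ℝ E) (x : E) : |f x| ≤ |f| |x| := by
  have h : ∀ y : E, 0 ≤ y → |f y| ≤ |f| y := by
    intro y hy
    refine abs_le'.2 ⟨(le_abs_self f) y hy, ?_⟩
    simpa using (neg_le_abs f) y hy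
  calc |f x| = |f x⁺ - f x⁻| := by rw [← map_sub, posPart_sub_negPart]
    _ ≤ |f x⁺| + |f x⁻| := abs_sub _ _
    _ ≤ |f| x⁺ + |f| x⁻ := add_le_add (h _ (posPart_nonneg x)) (h _ (negPart_nonneg x))
    _ = |f| |x| := by rw [← map_add, posPart_add_negPart]

theorem norm_dualPosPart_le (f : StrongDual ℝ E) : ‖dualPosPart f‖ ≤ ‖f‖ :=
  ContinuousLinearMap.opNorm_le_bound _ (norm_nonneg _) (dualPosPartHom_bound f)

theorem dualPosPart_nonneg (f : StrongDual ℝ E) : 0 ≤ dualPosPart f := fun x hx => by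
  rw [dualPosPart_apply f hx]; exact rieszSup_nonneg f hx

theorem dual_inf_eq (f g : StrongDual ℝ E) : f ⊓ g = f - dualPosPart (f - g) := rfl

theorem norm_abs_dual_le (f : StrongDual ℝ E) : ‖|f|‖ ≤ 3 * ‖f‖ := by
  have h : |f| = -f + dualPosPart (f - -f) := rfl
  rw [h]
  refine (norm_add_le _ _).trans ?_
  have h1 := norm_dualPosPart_le (f - -f)
  have h2 := norm_sub_le f (-f)
  rw [norm_neg] at *
  linarith

/-- A positive functional of norm at most one attaining the norm at a given positive vector. -/
theorem exists_dual_nonneg_norming {v : E} (hv : 0 ≤ v) :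
    ∃ f : StrongDual ℝ E, 0 ≤ f ∧ ‖f‖ ≤ 1 ∧ ‖v‖ ≤ f v := by
  obtain ⟨f, hf, hfv⟩ := exists_dual_vector'' ℝ v
  refine ⟨dualPosPart f, dualPosPart_nonneg f, (norm_dualPosPart_le f).trans hf, ?_⟩
  rw [dualPosPart_apply f hv]
  calc ‖v‖ = f v := by simpa using hfv.symm
    _ ≤ _ := le_rieszSup f hv le_rfl

/-- A bounded nonnegative additive function on the positive cone extends to a functional. -/
theorem exists_dual_of_additive_on_nonneg (φ : E → ℝ) {C : ℝ} (hC : 0 ≤ C)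
    (hadd : ∀ a b, 0 ≤ a → 0 ≤ b → φ (a + b) = φ a + φ b)
    (hφ : ∀ a, 0 ≤ a → 0 ≤ φ a) (hφC : ∀ a, 0 ≤ a → φ a ≤ C * ‖a‖) :
    ∃ g : StrongDual ℝ E, 0 ≤ g ∧ ‖g‖ ≤ C ∧ ∀ a, 0 ≤ a → g a = φ a := by
  have hext : ∀ {x a b : E}, 0 ≤ a → 0 ≤ b → x = a - b → φ x⁺ - φ x⁻ = φ a - φ b := by
    intro x a b ha hb hx
    have h1 : x⁺ + b = a + x⁻ := by
      rw [← sub_eq_sub_iff_add_eq_add, posPart_sub_negPart, hx]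
    have h2 := congrArg φ h1
    rw [hadd _ _ (posPart_nonneg x) hb, hadd _ _ ha (negPart_nonneg x)] at h2
    linarith
  let G : E →+ ℝ := AddMonoidHom.mk' (fun x => φ x⁺ - φ x⁻) (by
    intro x y
    rw [hext (add_nonneg (posPart_nonneg x) (posPart_nonneg y))
      (add_nonneg (negPart_nonneg x) (negPart_nonneg y)) (x := x + y) (by
        conv_lhs => rw [← posPart_sub_negPart x, ← posPart_sub_negPart y]
        abel),
      hadd _ _ (posPart_nonneg x) (posPart_nonneg y),
      hadd _ _ (negPart_nonneg x) (negPart_nonneg y)]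
    ring)
  have hbound : ∀ x, ‖G x‖ ≤ C * ‖x‖ := by
    intro x
    have key : ∀ y : E, 0 ≤ y → y ≤ |x| → 0 ≤ φ y ∧ φ y ≤ C * ‖x‖ := fun y hy hyx =>
      ⟨hφ y hy, (hφC y hy).trans (mul_le_mul_of_nonneg_left
        (by simpa [norm_abs_eq_norm] using norm_le_norm_of_nonneg_of_le hy hyx) hC)⟩
    have h1 := key x⁺ (posPart_nonneg x) (sup_le (le_abs_self x) (abs_nonneg x))
    have h2 := key x⁻ (negPart_nonneg x) (sup_le (neg_le_abs x) (abs_nonneg x))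
    change |φ x⁺ - φ x⁻| ≤ _
    rw [abs_le]
    constructor <;> linarith
  have hzero : φ 0 = 0 := by simpa using hadd 0 0 le_rfl le_rfl
  have happ : ∀ a, 0 ≤ a → G a = φ a := by
    intro a ha
    change φ a⁺ - φ a⁻ = φ a
    rw [hext ha le_rfl (sub_zero a).symm, hzero, sub_zero]
  refine ⟨G.toRealLinearMap (AddMonoidHomClass.continuous_of_bound G C hbound), ?_,
    ContinuousLinearMap.opNorm_le_bound _ hC hbound, happ⟩
  intro x hx
  exact (hφ x hx).trans_eq (happ x hx).symm

/-- The part of a positive functional `f` carried by a positive vector `v`. -/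
theorem exists_dual_carried {f : StrongDual ℝ E} (hf : 0 ≤ f) {v : E} (hv : 0 ≤ v) :
    ∃ g : StrongDual ℝ E, 0 ≤ g ∧ ‖g‖ ≤ ‖f‖ ∧ (∀ y, 0 ≤ y → ∀ k : ℕ, f (y ⊓ k • v) ≤ g y) ∧
      ∀ y, 0 ≤ y → ∀ η > 0, ∃ k : ℕ, g y < f (y ⊓ k • v) + η := by
  have hkv : ∀ k : ℕ, 0 ≤ k • v := nsmul_nonneg hv
  let φ : E → ℝ := fun y => ⨆ k : ℕ, f (y ⊓ k • v)
  have hle : ∀ y, 0 ≤ y → ∀ k : ℕ, f (y ⊓ k • v) ≤ ‖f‖ * ‖y‖ := by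
    intro y hy k
    calc f (y ⊓ k • v) ≤ f y := dual_apply_mono hf inf_le_left
      _ ≤ ‖f y‖ := le_abs_self _
      _ ≤ _ := f.le_opNorm y
  have hbdd : ∀ y, 0 ≤ y → BddAbove (Set.range fun k : ℕ => f (y ⊓ k • v)) := by
    rintro y hy
    exact ⟨_, by rintro _ ⟨k, rfl⟩; exact hle y hy k⟩
  have hleφ : ∀ y, 0 ≤ y → ∀ k : ℕ, f (y ⊓ k • v) ≤ φ y := fun y hy k => le_ciSup (hbdd y hy) k
  obtain ⟨g, hg0, hgn, hg⟩ := exists_dual_of_additive_on_nonneg φ (norm_nonneg f) (by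
    intro a b ha hb
    apply le_antisymm
    · refine ciSup_le fun k => ?_
      refine le_trans ?_ (add_le_add (hleφ a ha k) (hleφ b hb k))
      rw [← map_add]
      apply dual_apply_mono hf
      rw [inf_comm, inf_comm a, inf_comm b]
      exact inf_add_le_inf_add_inf (hkv k) ha hb
    · refine ciSup_add_ciSup_le fun k l => ?_
      refine le_trans ?_ (hleφ (a + b) (add_nonneg ha hb) (k + l))
      rw [← map_add]
      apply dual_apply_mono hf
      rw [add_nsmul]
      exact le_inf (add_le_add inf_le_left inf_le_left) (add_le_add inf_le_right inf_le_right))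
    (fun a ha => (dual_apply_nonneg hf (le_inf ha (hkv 0))).trans (hleφ a ha 0))
    (fun a ha => ciSup_le (hle a ha))
  refine ⟨g, hg0, hgn, fun y hy k => (hg y hy).symm ▸ hleφ y hy k, fun y hy η hη => ?_⟩
  rw [hg y hy]
  obtain ⟨k, hk⟩ := exists_lt_of_lt_ciSup (show φ y - η < φ y by linarith)
  exact ⟨k, by linarith⟩

/-- If `v` is a disjoint sequence and each `g n` is carried by `v n`, then the sums of the
`g n ⊓ u` are bounded by `u`. -/
theorem sum_inf_le_of_carried {f g : ℕ → StrongDual ℝ E} {v : ℕ → E}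
    (hv : ∀ n, 0 ≤ v n) (hd : Pairwise fun m n => v m ⊓ v n = 0)
    (hgk : ∀ n y, 0 ≤ y → ∀ k : ℕ, f n (y ⊓ k • v n) ≤ g n y)
    (hgη : ∀ n y, 0 ≤ y → ∀ η > 0, ∃ k : ℕ, g n y < f n (y ⊓ k • v n) + η)
    {u : StrongDual ℝ E} (hu : 0 ≤ u) (s : Finset ℕ) {y : E} (hy : 0 ≤ y) :
    ∑ n ∈ s, (g n ⊓ u) y ≤ u y := by
  refine le_of_forall_pos_le_add fun ε hε => ?_
  set η : ℝ := ε / (s.card + 1) with hη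
  have hη0 : 0 < η := by positivity
  choose k hk using fun n => hgη n y hy η hη0
  let a : ℕ → E := fun n => y ⊓ k n • v n
  have ha : ∀ n, 0 ≤ a n := fun n => le_inf hy (nsmul_nonneg (hv n) _)
  have hay : ∀ n, a n ≤ y := fun n => inf_le_left
  have had : Pairwise fun m n => a m ⊓ a n = 0 := by
    intro m n hmn
    refine inf_eq_zero_mono (ha m) (ha n) inf_le_right inf_le_right ?_
    refine inf_nsmul_eq_zero (nsmul_nonneg (hv m) _) (hv n) ?_ _
    rw [inf_comm]
    exact inf_nsmul_eq_zero (hv n) (hv m) (hd hmn.symm) _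
  have hterm : ∀ n, (g n ⊓ u) y ≤ u (a n) + η := by
    intro n
    have h1 : (g n ⊓ u) (a n) ≤ u (a n) := (inf_le_right : g n ⊓ u ≤ u) _ (ha n)
    have h2 : (g n ⊓ u) (y - a n) ≤ g n (y - a n) :=
      (inf_le_left : g n ⊓ u ≤ g n) _ (sub_nonneg.2 (hay n))
    have h3 := hgk n (a n) (ha n) (k n)
    have h4 : a n ⊓ k n • v n = a n := inf_eq_left.2 inf_le_right
    rw [h4] at h3
    have h5 : g n y < f n (a n) + η := hk n
    rw [map_sub, map_sub] at h2
    linarith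
  calc ∑ n ∈ s, (g n ⊓ u) y ≤ ∑ n ∈ s, (u (a n) + η) := Finset.sum_le_sum fun n _ => hterm n
    _ = u (∑ n ∈ s, a n) + s.card * η := by
        rw [Finset.sum_add_distrib, map_sum, Finset.sum_const, nsmul_eq_mul]
    _ ≤ u y + ε := by
        refine add_le_add (dual_apply_mono hu (sum_le_of_pairwise_inf_eq_zero hy ha hay had s)) ?_
        rw [hη, mul_div_assoc', div_le_iff₀ (by positivity)]
        nlinarith

/-- A sequence of positive functionals whose partial sums are order bounded is weakly null. -/
theorem tendsto_toWeakSpace_of_sum_le {h : ℕ → StrongDual ℝ E} {u : StrongDual ℝ E}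
    (hh : ∀ n, 0 ≤ h n) (hu : ∀ (s : Finset ℕ) (y : E), 0 ≤ y → ∑ n ∈ s, h n y ≤ u y) :
    Tendsto (fun n => toWeakSpace ℝ (StrongDual ℝ E) (h n)) atTop (𝓝 0) := by
  have hweak : ∀ Φ : StrongDual ℝ (StrongDual ℝ E), Tendsto (fun n => Φ (h n)) atTop (𝓝 0) := by
    intro Φ
    have hsum : ∀ N, ∑ n ∈ Finset.range N, |Φ (h n)| ≤ ‖Φ‖ * ‖u‖ := by
      intro N
      let σ : ℕ → ℝ := fun n => SignType.sign (Φ (h n))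
      have hσ : ∀ n, |σ n| ≤ 1 := by
        intro n
        rcases lt_trichotomy (Φ (h n)) 0 with H | H | H <;> simp [σ, H]
      have h1 : ∑ n ∈ Finset.range N, |Φ (h n)| = Φ (∑ n ∈ Finset.range N, σ n • h n) := by
        rw [map_sum]
        refine Finset.sum_congr rfl fun n _ => ?_
        rw [map_smul, smul_eq_mul]
        exact (sign_mul_self _).symm
      have h2 : ‖∑ n ∈ Finset.range N, σ n • h n‖ ≤ ‖u‖ := by
        refine ContinuousLinearMap.opNorm_le_bound _ (norm_nonneg _) fun y => ?_
        rw [sum_apply, Real.norm_eq_abs]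
        calc |∑ n ∈ Finset.range N, (σ n • h n) y|
            ≤ ∑ n ∈ Finset.range N, |(σ n • h n) y| := Finset.abs_sum_le_sum_abs _ _
          _ ≤ ∑ n ∈ Finset.range N, h n |y| := by
              refine Finset.sum_le_sum fun n _ => ?_
              rw [smul_apply, smul_eq_mul, abs_mul]
              exact (mul_le_of_le_one_left (abs_nonneg _) (hσ n)).trans
                (abs_dual_apply_le_of_nonneg (hh n) y)
          _ ≤ u |y| := hu _ _ (abs_nonneg y)
          _ ≤ ‖u |y|‖ := le_abs_self _
          _ ≤ ‖u‖ * ‖|y|‖ := u.le_opNorm _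
          _ = ‖u‖ * ‖y‖ := by rw [norm_abs_eq_norm]
      calc ∑ n ∈ Finset.range N, |Φ (h n)| = Φ (∑ n ∈ Finset.range N, σ n • h n) := h1
        _ ≤ ‖Φ (∑ n ∈ Finset.range N, σ n • h n)‖ := le_abs_self _
        _ ≤ ‖Φ‖ * ‖∑ n ∈ Finset.range N, σ n • h n‖ := Φ.le_opNorm _
        _ ≤ ‖Φ‖ * ‖u‖ := by gcongr
    exact tendsto_zero_iff_abs_tendsto_zero _ |>.2
      (summable_of_sum_range_le (fun n => abs_nonneg _) hsum).tendsto_atTop_zero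
  have hinj : Function.Injective (topDualPairing ℝ (StrongDual ℝ E)).flip := by
    intro a b hab
    refine SeparatingDual.eq_iff_forall_dual_eq (R := ℝ) |>.2 fun Φ => ?_
    exact LinearMap.congr_fun hab Φ
  refine (WeakBilin.tendsto_iff_forall_eval_tendsto _ hinj).2 fun Φ => ?_
  change Tendsto (fun n => Φ (h n)) atTop (𝓝 (Φ 0))
  rw [map_zero]
  exact hweak Φ

theorem weakStarTendsto_zero_iff {ι F : Type*} [NormedAddCommGroup F] [NormedSpace ℝ F]
    {f : ι → StrongDual ℝ F} {l : Filter ι} :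
    WeakStarTendsto f l 0 ↔ ∀ x, Tendsto (fun i => f i x) l (𝓝 0) := by
  rw [WeakStarTendsto, map_zero]
  exact tendsto_iff_forall_eval_tendsto_topDualPairing

theorem AbsWeakStarTendsto.weakStarTendsto {ι : Type*} {f : ι → StrongDual ℝ E} {l : Filter ι}
    (h : AbsWeakStarTendsto f l 0) : WeakStarTendsto f l 0 := by
  refine weakStarTendsto_zero_iff.2 fun x => ?_
  refine squeeze_zero_norm (fun i => ?_) (h x)
  rw [sub_zero]
  exact abs_dual_apply_le (f i) x

theorem UAWTendsto.tendsto_dual_apply {ι : Type*} {f : ι → StrongDual ℝ E} {l : Filter ι}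
    (h : UAWTendsto f l 0) {u : StrongDual ℝ E} (hu : 0 ≤ u) (x : E) :
    Tendsto (fun i => (|f i| ⊓ u) x) l (𝓝 0) := by
  have h1 : Tendsto (fun i => (|f i - 0| ⊓ u) x) l (𝓝 0) :=
    (WeakBilin.eval_continuous (topDualPairing ℝ (StrongDual ℝ E)).flip
      (NormedSpace.inclusionInDoubleDual ℝ E x)).tendsto 0 |>.comp (h u hu)
  simpa only [sub_zero] using h1

/-- If norm bounded uaw-null sequences are weak* null, then disjoint order bounded sequences are
norm null. -/
theorem tendsto_norm_of_disjoint
    (H : ∀ f : ℕ → StrongDual ℝ E, Bornology.IsBounded (Set.range f) →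
      UAWTendsto f atTop 0 → WeakStarTendsto f atTop 0)
    (v : ℕ → E) (x : E) (hv : ∀ n, 0 ≤ v n) (hvx : ∀ n, v n ≤ x)
    (hd : Pairwise fun m n => v m ⊓ v n = 0) : Tendsto (fun n => ‖v n‖) atTop (𝓝 0) := by
  choose f hf0 hf1 hfv using fun n => exists_dual_nonneg_norming (hv n)
  choose g hg0 hgn hgk hgη using fun n => exists_dual_carried (hf0 n) (hv n)
  have hbdd : Bornology.IsBounded (Set.range g) := by
    refine isBounded_iff_forall_norm_le.2 ⟨1, ?_⟩
    rintro _ ⟨n, rfl⟩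
    exact (hgn n).trans (hf1 n)
  have huaw : UAWTendsto g atTop 0 := by
    intro u hu
    have h1 : ∀ n, |g n - 0| ⊓ u = g n ⊓ u := fun n => by rw [sub_zero, abs_of_nonneg (hg0 n)]
    simp only [h1]
    exact tendsto_toWeakSpace_of_sum_le (fun n => le_inf (hg0 n) hu)
      fun s y hy => sum_inf_le_of_carried hv hd hgk hgη hu s hy
  have hx : Tendsto (fun n => g n x) atTop (𝓝 0) := weakStarTendsto_zero_iff.1 (H g hbdd huaw) x
  refine squeeze_zero (fun n => norm_nonneg _) (fun n => ?_) hx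
  calc ‖v n‖ ≤ f n (v n) := hfv n
    _ = f n (v n ⊓ 1 • v n) := by rw [one_nsmul, inf_idem]
    _ ≤ g n (v n) := hgk n _ (hv n) 1
    _ ≤ g n x := dual_apply_mono (hg0 n) (hvx n)

end DualLattice


section DualOfOrderContinuous

variable {E : Type*} [NormedAddCommGroup E] [NormedSpace ℝ E] [CompleteSpace E] [Lattice E]
  [IsOrderedAddMonoid E] [HasSolidNorm E]

/-- Let `y n` be in an order interval of an order continuous Banach lattice and let `F n` be norm
bounded positive functionals. If `F i (y n)` decays geometrically in `n > i`, then the `F n (y n)`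
are not bounded away from `0`. -/
theorem IsOrderContinuous.exists_dual_apply_le (hE : IsOrderContinuous E) {x : E} {y : ℕ → E}
    (hy0 : ∀ n, 0 ≤ y n) (hyx : ∀ n, y n ≤ x) {F : ℕ → StrongDual ℝ E} {C D : ℝ}
    (hF0 : ∀ n, 0 ≤ F n) (hFC : ∀ n, ‖F n‖ ≤ C)
    (hFy : ∀ i n, i < n → F i (y n) ≤ D * (1 / 2) ^ n) {ε : ℝ} (hε : 0 < ε) :
    ∃ n, F n (y n) ≤ ε := by
  by_contra! hcon
  let W : ℕ → ℕ → E := fun n m => partialSups (fun k => y (n + k)) m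
  have hWx : ∀ n m, W n m ≤ x := fun n m => partialSups_le _ _ _ fun j _ => hyx _
  have hWmono : ∀ n, Monotone (W n) := fun n => (partialSups _).monotone
  choose w hw using fun n =>
    cauchySeq_tendsto_of_complete (hE.cauchySeq_of_monotone (hWmono n) (hWx n))
  have hyw : ∀ n, y n ≤ w n := fun n =>
    ge_of_tendsto' (hw n) fun m => le_partialSups_of_le (fun k => y (n + k)) (Nat.zero_le m)
  have hw0 : ∀ n, 0 ≤ w n := fun n => (hy0 n).trans (hyw n)
  have hwanti : Antitone w := by
    refine antitone_nat_of_succ_le fun n => ?_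
    refine le_of_tendsto_of_tendsto' (hw (n + 1)) ((tendsto_add_atTop_iff_nat 1).2 (hw n)) ?_
    intro m
    refine partialSups_le _ _ _ fun j hj => ?_
    rw [add_assoc, add_comm 1 j]
    exact le_partialSups_of_le (fun k => y (n + k)) (Nat.succ_le_succ hj)
  have hWsum : ∀ n m, W n m ≤ ∑ k ∈ Finset.range (m + 1), y (n + k) := by
    intro n m
    refine partialSups_le _ _ _ fun j hj => ?_
    exact Finset.single_le_sum (f := fun k => y (n + k)) (fun k _ => hy0 _)
      (Finset.mem_range.2 (Nat.lt_succ_of_le hj))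
  have hD : 0 ≤ D := by
    have h1 := (dual_apply_nonneg (hF0 0) (hy0 1)).trans (hFy 0 1 one_pos)
    linarith
  have hFw : ∀ i n, i < n → F i (w n) ≤ 2 * D * (1 / 2) ^ n := by
    intro i n hin
    refine le_of_tendsto' (((F i).continuous.tendsto _).comp (hw n)) fun m => ?_
    calc F i (W n m) ≤ F i (∑ k ∈ Finset.range (m + 1), y (n + k)) :=
          dual_apply_mono (hF0 i) (hWsum n m)
      _ = ∑ k ∈ Finset.range (m + 1), F i (y (n + k)) := map_sum _ _ _
      _ ≤ ∑ k ∈ Finset.range (m + 1), D * (1 / 2) ^ n * (1 / 2) ^ k := by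
          refine Finset.sum_le_sum fun k _ => ?_
          rw [mul_assoc, ← pow_add]
          exact hFy i (n + k) (by omega)
      _ = D * (1 / 2) ^ n * ∑ k ∈ Finset.range (m + 1), (1 / 2) ^ k := by rw [Finset.mul_sum]
      _ ≤ D * (1 / 2) ^ n * 2 := by
          gcongr
          exact sum_geometric_two_le _
      _ = _ := by ring
  have hcau := hE.cauchySeq_of_monotone (y := fun n => w 0 - w n) (x := w 0)
    (fun m n hmn => sub_le_sub_left (hwanti hmn) _) (fun n => sub_le_self _ (hw0 n))
  obtain ⟨b, hb⟩ := cauchySeq_tendsto_of_complete hcau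
  have hlim : Tendsto w atTop (𝓝 (w 0 - b)) := by
    simpa using (tendsto_const_nhds (x := w 0)).sub hb
  set a := w 0 - b
  have hFa : ∀ i, F i a ≤ 0 := by
    intro i
    have h1 : Tendsto (fun n : ℕ => 2 * D * (1 / 2 : ℝ) ^ n) atTop (𝓝 (2 * D * 0)) :=
      (tendsto_pow_atTop_nhds_zero_of_lt_one (by norm_num) (by norm_num)).const_mul _
    rw [mul_zero] at h1
    exact le_of_tendsto_of_tendsto (((F i).continuous.tendsto _).comp hlim) h1
      ((eventually_gt_atTop i).mono fun n hn => hFw i n hn)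
  have hC : 0 ≤ C := (norm_nonneg _).trans (hFC 0)
  have hfin : Tendsto (fun n => C * ‖w n - a‖) atTop (𝓝 0) := by
    have := ((hlim.sub_const a).norm).const_mul C
    simpa using this
  obtain ⟨n, hn⟩ := ((tendsto_order.1 hfin).2 ε hε).exists
  have h1 : F n (w n - a) ≤ C * ‖w n - a‖ :=
    (le_abs_self _).trans (((F n).le_opNorm _).trans
      (mul_le_mul_of_nonneg_right (hFC n) (norm_nonneg _)))
  have h2 := dual_apply_mono (hF0 n) (hyw n)
  rw [map_sub] at h1
  linarith [hFa n, hcon n]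

/-- In an order continuous Banach lattice, norm bounded sets of positive functionals are
approximately order bounded with respect to evaluation at a positive vector. -/
theorem IsOrderContinuous.exists_dualPosPart_sub_le (hE : IsOrderContinuous E) {x : E}
    (hx : 0 ≤ x) (C : ℝ) {ε : ℝ} (hε : 0 < ε) :
    ∃ u : StrongDual ℝ E, 0 ≤ u ∧
      ∀ f : StrongDual ℝ E, 0 ≤ f → ‖f‖ ≤ C → dualPosPart (f - u) x ≤ ε := by
  by_contra! hcon
  have hcon' : ∀ u : {u : StrongDual ℝ E // 0 ≤ u}, ∃ f : StrongDual ℝ E, 0 ≤ f ∧ ‖f‖ ≤ C ∧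
      ∃ z, 0 ≤ z ∧ z ≤ x ∧ ε < (f - u.1) z := by
    intro u
    obtain ⟨f, hf0, hfC, hf⟩ := hcon u.1 u.2
    refine ⟨f, hf0, hfC, ?_⟩
    by_contra! hz
    rw [dualPosPart_apply _ hx] at hf
    exact absurd (rieszSup_le _ hx hz) (not_le.2 hf)
  choose f hf0 hfC z hz0 hzx hfz using hcon'
  let P := {u : StrongDual ℝ E // 0 ≤ u}
  let T : ℕ → P → P := fun n u => ⟨2 ^ n • u.1, nsmul_nonneg u.2 _⟩
  let S : ℕ → P := fun n =>
    Nat.rec ⟨0, le_rfl⟩ (fun n u => ⟨u.1 + f (T n u), add_nonneg u.2 (hf0 _)⟩) n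
  let F : ℕ → StrongDual ℝ E := fun n => f (T n (S n))
  let y : ℕ → E := fun n => z (T n (S n))
  have hS : ∀ n, (S (n + 1)).1 = (S n).1 + F n := fun n => rfl
  have hSmono : Monotone fun n => (S n).1 :=
    monotone_nat_of_le_succ fun n => by rw [hS]; exact le_add_of_nonneg_right (hf0 _)
  have hFS : ∀ i n, i < n → F i ≤ (S n).1 := by
    intro i n hin
    calc F i ≤ (S i).1 + F i := le_add_of_nonneg_left (S i).2
      _ ≤ (S n).1 := hSmono (Nat.succ_le_of_lt hin)
  have hmain : ∀ n, ε < F n (y n) - 2 ^ n * (S n).1 (y n) := by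
    intro n
    have h1 : ε < (F n - 2 ^ n • (S n).1) (y n) := hfz (T n (S n))
    rw [sub_apply, smul_apply, nsmul_eq_mul] at h1
    simpa using h1
  have hFle : ∀ n, F n (y n) ≤ C * ‖x‖ := by
    intro n
    calc F n (y n) ≤ F n x := dual_apply_mono (hf0 _) (hzx _)
      _ ≤ ‖F n x‖ := le_abs_self _
      _ ≤ ‖F n‖ * ‖x‖ := (F n).le_opNorm x
      _ ≤ C * ‖x‖ := mul_le_mul_of_nonneg_right (hfC _) (norm_nonneg _)
  obtain ⟨n, hn⟩ := hE.exists_dual_apply_le (y := y) (F := F) (D := C * ‖x‖) (fun n => hz0 _)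
    (fun n => hzx _) (fun n => hf0 _) (fun n => hfC _) (by
      intro i n hin
      have h1 : F i (y n) ≤ (S n).1 (y n) := hFS i n hin _ (hz0 _)
      refine h1.trans ?_
      rw [one_div, inv_pow, ← div_eq_mul_inv, le_div_iff₀ (by positivity)]
      linarith [hmain n, hFle n]) hε
  have h1 : 0 ≤ (2 : ℝ) ^ n * (S n).1 (y n) :=
    mul_nonneg (by positivity) (dual_apply_nonneg (S n).2 (hz0 _))
  linarith [hmain n]

theorem IsOrderContinuous.absWeakStarTendsto (hE : IsOrderContinuous E)
    {f : ℕ → StrongDual ℝ E} (hf : Bornology.IsBounded (Set.range f))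
    (h : UAWTendsto f atTop 0) : AbsWeakStarTendsto f atTop 0 := by
  intro x
  simp only [sub_zero]
  obtain ⟨C, hC⟩ := isBounded_iff_forall_norm_le.1 hf
  have hfC : ∀ n, ‖|f n|‖ ≤ 3 * C := fun n =>
    (norm_abs_dual_le _).trans (by linarith [hC _ ⟨n, rfl⟩])
  rw [tendsto_order]
  refine ⟨fun a ha => Eventually.of_forall fun n =>
    ha.trans_le (dual_apply_nonneg (abs_nonneg _) (abs_nonneg x)), fun ε hε => ?_⟩
  obtain ⟨u, hu, huf⟩ := hE.exists_dualPosPart_sub_le (abs_nonneg x) (3 * C) (half_pos hε)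
  refine ((tendsto_order.1 (h.tendsto_dual_apply hu |x|)).2 (ε / 2) (half_pos hε)).mono ?_
  intro n hn
  have h1 := huf _ (abs_nonneg (f n)) (hfC n)
  rw [dual_inf_eq, sub_apply] at hn
  linarith

end DualOfOrderContinuous

end BanachLattice

theorem mainTheorem7 {E : Type*} [NormedAddCommGroup E] [NormedSpace ℝ E] [CompleteSpace E]
    [Lattice E] [IsOrderedAddMonoid E] [IsOrderedModule ℝ E] [HasSolidNorm E] :
    List.TFAE [
      BanachLattice.IsOrderContinuous E,
      ∀ f : ℕ → StrongDual ℝ E, Bornology.IsBounded (Set.range f) →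
        BanachLattice.UAWTendsto f atTop 0 → BanachLattice.WeakStarTendsto f atTop 0,
      ∀ f : ℕ → StrongDual ℝ E, Bornology.IsBounded (Set.range f) →
        BanachLattice.UAWTendsto f atTop 0 → BanachLattice.AbsWeakStarTendsto f atTop 0] := by
  tfae_have 1 → 3 := fun hE f hf h => hE.absWeakStarTendsto hf h
  tfae_have 3 → 2 := fun H f hf h => (H f hf h).weakStarTendsto
  tfae_have 2 → 1 := fun H => BanachLattice.isOrderContinuous_of_increments
    fun _ _ hy hy0 hyx => BanachLattice.tendsto_increments_of_disjoint
      (BanachLattice.tendsto_norm_of_disjoint H) hy hy0 hyx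
  tfae_finish
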